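/- **Theorem (Hurewicz isomorphism for quandles).** A quandle is a set $Q$ with a binary operation $\ast$ such that $a\ast a=a$, every map $x\mapsto x\ast b$ is a bijection of $Q$, and $(a\ast b)\ast c=(a\ast c)\ast(b\ast c)$. Let $\operatorname{Inn}(Q)$ be the group of permutations of $Q$ generated by the maps $x\mapsto x\ast b$; its orbits are the connected components of $Q$. Let $\operatorname{Adj}(Q)=\langle Q\mid a\ast b=b^{-1}ab\rangle$, let $\operatorname{adj}(b)\in\operatorname{Adj}(Q)$ be the generator given by $b\in Q$, let $\varepsilon\colon\operatorname{Adj}(Q)\to\mathbb Z$ be the homomorphism with $\varepsilon(\operatorname{adj}(b))=1$ for all $b\in Q$, and let $\operatorname{Adj}(Q)$ act on $Q$ from the right, $\operatorname{adj}(b)$ acting as $x\mapsto x\ast b$. For $q\in Q$ put $$\pi_1(Q,q)=\{g\in\operatorname{Adj}(Q)\mid \varepsilon(g)=0,\ q^g=q\},$$ and let $\pi_1(Q,q)_{\mathrm{ab}}$ be its abelianization. Let $C_n(Q)$ be the free abelian group on $Q^n$ modulo the tuples having two equal consecutive entries, with boundary $$\partial(x_1,\dots,x_n)=\sum_{i=2}^n(-1)^i\bigl[(x_1,\dots,\widehat{x_i},\dots,x_n)-(x_1\ast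 x_i,\dots,x_{i-1}\ast x_i,x_{i+1},\dots,x_n)\bigr],$$ and let $H_2(Q)=\ker(\partial\colon C_2(Q)\to C_1(Q))/\operatorname{im}(\partial\colon C_3(Q)\to C_2(Q))$ be the second quandle homology group. Fix a set $I$. A quandle $Q$ with a family $q=(q_i)_{i\in I}$ of elements of $Q$ is well-pointed if each connected component of $Q$ contains $q_i$ for exactly one $i\in I$; write $Q_i$ for the component of $q_i$, and $H_2(Q)_i\subset H_2(Q)$ for the subgroup of classes represented by cycles that are linear combinations of pairs $(a,b)$ with $a\in Q_i$ and $b\in Q$. Then there are isomorphisms $$\Phi_{(Q,q)}\colon H_2(Q)\ \xrightarrow{\ \sim\ }\ \bigoplus_{i\in I}\pi_1(Q,q_i)_{\mathrm{ab}},$$ one for every well-pointed quandle $(Q,q)$ indexed by $I$, which are * graded: for every $i\in I$, $\Phi_{(Q,q)}$ maps $H_2(Q)_i$ onto the $i$-th summand $\pi_1(Q,q_i)_{\mathrm{ab}}$; * natural: for all well-pointed quandles $(Q,q)$, $(Q',q')$ indexed by $I$ and every quandle homomorphism $f\colon Q\to Q'$ with $f(q_i)=q'_i$ for all $i\in I$,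 one has $\Phi_{(Q',q')}\circ f_*=\bigl(\bigoplus_{i\in I}f_*\bigr)\circ\Phi_{(Q,q)}$, where $f_*$ denotes the induced homomorphisms $H_2(Q)\to H_2(Q')$ and $\pi_1(Q,q_i)_{\mathrm{ab}}\to\pi_1(Q',q'_i)_{\mathrm{ab}}$. -/

import Mathlib

universe u v

namespace QuandleHurewicz

open Quandles

/-! Mathlib writes quandles with a left action `x ◃ y` (the element `x` acts on `y`).  The right
operation `a ∗ b` (the element `b` acts on `a`) used below is `b ◃ a`. -/

/-- The quandle operation written on the right: `a ∗ b` is the result of acting by `b` on `a`. -/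
def rop {Q : Type*} [Quandle Q] (a b : Q) : Q := b ◃ a

infixl:70 " ∗ " => rop

section Basic

variable {Q : Type*} [Quandle Q]

theorem rop_self (a : Q) : a ∗ a = a := Quandle.fix

theorem rop_distrib (a b c : Q) : (a ∗ b) ∗ c = (a ∗ c) ∗ (b ∗ c) := Shelf.self_distrib

theorem map_rop {Q' : Type*} [Quandle Q'] (f : Q →◃ Q') (a b : Q) :
    f (a ∗ b) = f a ∗ f b := f.map_act

end Basic

/-! ### Inner automorphisms and connected components -/

/-- The group `Inn(Q)` of inner automorphisms: the group of permutations of `Q` generated by the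
maps `x ↦ x ∗ a`. -/
def Inn (Q : Type*) [Quandle Q] : Subgroup (Equiv.Perm Q) :=
  Subgroup.closure (Set.range fun a : Q => Rack.act' a)

/-- The connected component `[q]` of `q`: its orbit under `Inn(Q)`. -/
def component {Q : Type*} [Quandle Q] (q : Q) : Set Q := MulAction.orbit (Inn Q) q

/-- The set `π₀(Q)` of connected components. -/
def Pi0 (Q : Type*) [Quandle Q] : Type _ := MulAction.orbitRel.Quotient (Inn Q) Q

/-- The canonical projection `Q → π₀(Q)`. -/
def toPi0 {Q : Type*} [Quandle Q] (q : Q) : Pi0 Q :=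
  Quotient.mk (MulAction.orbitRel (Inn Q) Q) q

/-- `(Q, q)` is well-pointed: the family `q` picks exactly one base point in each connected
component of `Q`. -/
def WellPointed {I Q : Type*} [Quandle Q] (q : I → Q) : Prop :=
  Function.Bijective fun i => toPi0 (q i)

/-! ### The adjoint group and the fundamental group -/

/-- The defining relations `a ∗ b = b⁻¹ a b` of the adjoint group. -/
def adjRels (Q : Type*) [Quandle Q] : Set (FreeGroup Q) :=
  {r | ∃ a b : Q, r = (FreeGroup.of (a ∗ b))⁻¹ *
    ((FreeGroup.of b)⁻¹ * FreeGroup.of a * FreeGroup.of b)}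

/-- The adjoint group `Adj(Q) = ⟨ Q ∣ a ∗ b = b⁻¹ a b ⟩`. -/
abbrev Adj (Q : Type*) [Quandle Q] : Type _ := PresentedGroup (adjRels Q)

section Adjoint

variable {Q : Type*} [Quandle Q]

/-- The canonical map `adj : Q → Adj(Q)`. -/
def adj (a : Q) : Adj Q := PresentedGroup.of a

theorem adj_rop (a b : Q) : adj (a ∗ b) = (adj b)⁻¹ * adj a * adj b := by
  have h := PresentedGroup.one_of_mem (rels := adjRels Q) ⟨a, b, rfl⟩
  simp only [map_mul, map_inv] at h
  exact inv_mul_eq_one.mp h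

/-- The homomorphism from `Adj(Q)` induced by a representation of `Q` in a group. -/
def Adj.lift {G : Type*} [Group G] (φ : Q → G) (h : ∀ a b, φ (a ∗ b) = (φ b)⁻¹ * φ a * φ b) :
    Adj Q →* G :=
  PresentedGroup.toGroup (f := φ) (by
    rintro r ⟨a, b, rfl⟩
    simp [h, mul_assoc])

@[simp] theorem Adj.lift_adj {G : Type*} [Group G] (φ : Q → G)
    (h : ∀ a b, φ (a ∗ b) = (φ b)⁻¹ * φ a * φ b) (a : Q) : Adj.lift φ h (adj a) = φ a :=
  PresentedGroup.toGroup.of _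

/-- The homomorphism `ε : Adj(Q) → ℤ` with `ε (adj a) = 1` for all `a`. -/
def Adj.eps : Adj Q →* Multiplicative ℤ :=
  Adj.lift (fun _ => Multiplicative.ofAdd 1) (by intro a b; simp)

/-- The right action of `Adj(Q)` on `Q` by inner automorphisms, for which `adj b` acts as
`a ↦ a ∗ b`.  A right action is a homomorphism to the opposite of the permutation group. -/
def Adj.rho : Adj Q →* (Equiv.Perm Q)ᵐᵒᵖ :=
  Adj.lift (fun b => MulOpposite.op (Rack.act' b)) (by
    intro a b
    apply MulOpposite.unop_injective
    simp only [MulOpposite.unop_mul, MulOpposite.unop_inv, MulOpposite.unop_op]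
    rw [← mul_assoc]
    exact Rack.ad_conj b a)

/-- `a ^ g`, the right action of `g ∈ Adj(Q)` on `a ∈ Q`. -/
def Adj.act (a : Q) (g : Adj Q) : Q := (Adj.rho g).unop a

theorem Adj.act_adj (a b : Q) : Adj.act a (adj b) = a ∗ b := by
  simp [Adj.act, Adj.rho, rop]

theorem Adj.act_one (a : Q) : Adj.act a 1 = a := by simp [Adj.act]

theorem Adj.act_mul (a : Q) (g h : Adj Q) : Adj.act a (g * h) = Adj.act (Adj.act a g) h := by
  simp [Adj.act]

theorem Adj.act_inv_eq (a b : Q) (g : Adj Q) (h : Adj.act a g = b) : Adj.act b g⁻¹ = a := by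
  rw [← h, ← Adj.act_mul, mul_inv_cancel, Adj.act_one]

/-- The fundamental group `π₁(Q, q) = { g ∈ Adj(Q)° ∣ q ^ g = q }`, where `Adj(Q)°` is the kernel
of `ε`. -/
def piOne (q : Q) : Subgroup (Adj Q) where
  carrier := {g | g ∈ (Adj.eps : Adj Q →* Multiplicative ℤ).ker ∧ Adj.act q g = q}
  one_mem' := ⟨one_mem _, Adj.act_one q⟩
  mul_mem' := fun ha hb => ⟨mul_mem ha.1 hb.1, by rw [Adj.act_mul, ha.2, hb.2]⟩
  inv_mem' := fun ha => ⟨inv_mem ha.1, Adj.act_inv_eq _ _ _ ha.2⟩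

variable {Q' : Type*} [Quandle Q']

/-- The homomorphism `Adj(f) : Adj(Q) → Adj(Q')` induced by a quandle homomorphism `f`. -/
def Adj.map (f : Q →◃ Q') : Adj Q →* Adj Q' :=
  Adj.lift (fun a => adj (f a)) (by intro a b; rw [map_rop, adj_rop])

@[simp] theorem Adj.map_adj (f : Q →◃ Q') (a : Q) : Adj.map f (adj a) = adj (f a) :=
  Adj.lift_adj _ _ a

theorem Adj.eps_map (f : Q →◃ Q') (g : Adj Q) : Adj.eps (Adj.map f g) = Adj.eps g := by
  have h : (Adj.eps.comp (Adj.map f)) = (Adj.eps : Adj Q →* Multiplicative ℤ) := by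
    apply PresentedGroup.ext
    intro a
    change Adj.eps (Adj.map f (adj a)) = Adj.eps (adj a)
    simp [Adj.eps]
  exact DFunLike.congr_fun h g

theorem Adj.map_act (f : Q →◃ Q') (g : Adj Q) (a : Q) :
    f (Adj.act a g) = Adj.act (f a) (Adj.map f g) := by
  let S : Subgroup (Adj Q) :=
    { carrier := {g | ∀ a, f (Adj.act a g) = Adj.act (f a) (Adj.map f g)}
      one_mem' := fun a => by simp [Adj.act_one]
      mul_mem' := fun {g h} hg hh a => by
        rw [Adj.act_mul, hh, hg, map_mul, Adj.act_mul]
      inv_mem' := fun {g} hg a => by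
        have h1 := hg (Adj.act a g⁻¹)
        rw [← Adj.act_mul, inv_mul_cancel, Adj.act_one] at h1
        rw [map_inv]
        exact (Adj.act_inv_eq _ _ _ h1.symm).symm }
  have hS : S = ⊤ := by
    rw [eq_top_iff, ← PresentedGroup.closure_range_of, Subgroup.closure_le]
    rintro _ ⟨b, rfl⟩ a
    change f (Adj.act a (adj b)) = Adj.act (f a) (Adj.map f (adj b))
    rw [Adj.map_adj, Adj.act_adj, Adj.act_adj, map_rop]
  have : g ∈ S := hS ▸ Subgroup.mem_top g
  exact this a

/-- The homomorphism `f_* : π₁(Q, q) → π₁(Q', q')` induced by a quandle homomorphism `f`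
with `f q = q'`. -/
def piOneMap (f : Q →◃ Q') {q : Q} {q' : Q'} (h : f q = q') : piOne q →* piOne q' :=
  ((Adj.map f).comp (piOne q).subtype).codRestrict (piOne q') (by
    rintro ⟨g, hg⟩
    refine ⟨?_, ?_⟩
    · rw [MonoidHom.mem_ker]
      exact (Adj.eps_map f g).trans hg.1
    · change Adj.act q' (Adj.map f g) = q'
      rw [← h, ← Adj.map_act, hg.2])

end Adjoint

/-- The abelianization `π₁(Q, q)_ab`, written additively. -/
abbrev PiOneAb {Q : Type*} [Quandle Q] (q : Q) : Type _ := Additive (Abelianization (piOne q))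

/-- The homomorphism induced on abelianized fundamental groups. -/
def piOneAbMap {Q Q' : Type*} [Quandle Q] [Quandle Q'] (f : Q →◃ Q') {q : Q} {q' : Q'}
    (h : f q = q') : PiOneAb q →+ PiOneAb q' :=
  MonoidHom.toAdditive (Abelianization.map (piOneMap f h))

/-! ### Quandle homology in degree two

The quandle chain group `C_n(Q)` is the free abelian group on `n`-tuples of elements of `Q` modulo
the tuples with two equal consecutive entries; the boundary is
`∂(x₁,…,xₙ) = ∑_{i=2}^n (-1)^i [(x₁,…,x̂ᵢ,…,xₙ) - (x₁ ∗ xᵢ,…,xᵢ₋₁ ∗ xᵢ,xᵢ₊₁,…,xₙ)]`.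
Only the part `C₃ → C₂ → C₁` enters the definition of `H₂`. -/

section Homology

/-- Degenerate chains in degree `2`, generated by the pairs `(a, a)`. -/
def D2 (Q : Type*) [Quandle Q] : AddSubgroup (FreeAbelianGroup (Q × Q)) :=
  AddSubgroup.closure {x | ∃ a : Q, x = FreeAbelianGroup.of (a, a)}

/-- Degenerate chains in degree `3`, generated by the triples `(a, a, b)` and `(a, b, b)`. -/
def D3 (Q : Type*) [Quandle Q] : AddSubgroup (FreeAbelianGroup (Q × Q × Q)) :=
  AddSubgroup.closure {x | ∃ a b : Q,
    x = FreeAbelianGroup.of (a, a, b) ∨ x = FreeAbelianGroup.of (a, b, b)}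

/-- Quandle chains of degree `1`. -/
abbrev C1 (Q : Type*) [Quandle Q] : Type _ := FreeAbelianGroup Q

/-- Quandle chains of degree `2`. -/
abbrev C2 (Q : Type*) [Quandle Q] : Type _ := FreeAbelianGroup (Q × Q) ⧸ D2 Q

/-- Quandle chains of degree `3`. -/
abbrev C3 (Q : Type*) [Quandle Q] : Type _ := FreeAbelianGroup (Q × Q × Q) ⧸ D3 Q

variable {Q : Type*} [Quandle Q]

/-- The class of the pair `(a, b)` in `C₂(Q)`. -/
def c2 (a b : Q) : C2 Q := QuotientAddGroup.mk' (D2 Q) (FreeAbelianGroup.of (a, b))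

/-- The class of the triple `(a, b, c)` in `C₃(Q)`. -/
def c3 (a b c : Q) : C3 Q := QuotientAddGroup.mk' (D3 Q) (FreeAbelianGroup.of (a, b, c))

theorem c2_self (a : Q) : c2 a a = 0 :=
  (QuotientAddGroup.eq_zero_iff _).2 (AddSubgroup.subset_closure ⟨a, rfl⟩)

theorem c3_left (a b : Q) : c3 a a b = 0 :=
  (QuotientAddGroup.eq_zero_iff _).2 (AddSubgroup.subset_closure ⟨a, b, Or.inl rfl⟩)

theorem c3_right (a b : Q) : c3 a b b = 0 :=
  (QuotientAddGroup.eq_zero_iff _).2 (AddSubgroup.subset_closure ⟨a, b, Or.inr rfl⟩)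

/-- The boundary `∂(a, b) = (a) - (a ∗ b)`. -/
def d2 (Q : Type*) [Quandle Q] : C2 Q →+ C1 Q :=
  QuotientAddGroup.lift (D2 Q)
    (FreeAbelianGroup.lift fun x : Q × Q =>
      FreeAbelianGroup.of x.1 - FreeAbelianGroup.of (x.1 ∗ x.2)) (by
    rw [D2, AddSubgroup.closure_le]
    rintro _ ⟨a, rfl⟩
    simp [rop_self])

/-- The boundary `∂(a, b, c) = [(a, c) - (a ∗ b, c)] - [(a, b) - (a ∗ c, b ∗ c)]`. -/
def d3 (Q : Type*) [Quandle Q] : C3 Q →+ C2 Q :=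
  QuotientAddGroup.lift (D3 Q)
    (FreeAbelianGroup.lift fun x : Q × Q × Q =>
      (c2 x.1 x.2.2 - c2 (x.1 ∗ x.2.1) x.2.2) -
        (c2 x.1 x.2.1 - c2 (x.1 ∗ x.2.2) (x.2.1 ∗ x.2.2))) (by
    rw [D3, AddSubgroup.closure_le]
    rintro _ ⟨a, b, rfl | rfl⟩
    · simp [rop_self, c2_self]
    · simp [rop_self])

theorem d2_c2 (a b : Q) :
    d2 Q (c2 a b) = FreeAbelianGroup.of a - FreeAbelianGroup.of (a ∗ b) := by
  simp [d2, c2]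

theorem d3_c3 (a b c : Q) :
    d3 Q (c3 a b c) = (c2 a c - c2 (a ∗ b) c) - (c2 a b - c2 (a ∗ c) (b ∗ c)) := by
  simp [d3, c3]

theorem d2_comp_d3 : (d2 Q).comp (d3 Q) = 0 := by
  apply QuotientAddGroup.addMonoidHom_ext
  apply FreeAbelianGroup.lift_ext
  rintro ⟨a, b, c⟩
  change d2 Q (d3 Q (c3 a b c)) = 0
  rw [d3_c3]
  simp only [map_sub, d2_c2]
  rw [rop_distrib a b c]
  abel

/-- The second quandle homology group `H₂(Q) = ker ∂₂ / im ∂₃`. -/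
abbrev H2 (Q : Type*) [Quandle Q] : Type _ :=
  (d2 Q).ker ⧸ ((d3 Q).range.addSubgroupOf (d2 Q).ker)

/-- The part of `C₂(Q)` of degree `[q]`, generated by the pairs `(a, b)` with `a` in the connected
component of `q`. -/
def C2Part (q : Q) : AddSubgroup (C2 Q) :=
  AddSubgroup.closure {x | ∃ a b : Q, a ∈ component q ∧ x = c2 a b}

/-- The part of `H₂(Q)` of degree `[q]`: the classes represented by cycles in the part of `C₂(Q)`
of degree `[q]`. -/
def H2Part (q : Q) : AddSubgroup (H2 Q) :=
  ((C2Part q).addSubgroupOf (d2 Q).ker).map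
    (QuotientAddGroup.mk' ((d3 Q).range.addSubgroupOf (d2 Q).ker))

variable {Q' : Type*} [Quandle Q']

/-- The chain map `(a, b) ↦ (f a, f b)` in degree `2`. -/
def C2map (f : Q →◃ Q') : C2 Q →+ C2 Q' :=
  QuotientAddGroup.lift (D2 Q) (FreeAbelianGroup.lift fun x : Q × Q => c2 (f x.1) (f x.2)) (by
    rw [D2, AddSubgroup.closure_le]
    rintro _ ⟨a, rfl⟩
    simp [c2_self])

theorem C2map_c2 (f : Q →◃ Q') (a b : Q) : C2map f (c2 a b) = c2 (f a) (f b) := by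
  simp [C2map, c2]

theorem d2_C2map (f : Q →◃ Q') (x : C2 Q) :
    d2 Q' (C2map f x) = FreeAbelianGroup.map f (d2 Q x) := by
  have h : (d2 Q').comp (C2map f) = (FreeAbelianGroup.map f).comp (d2 Q) := by
    apply QuotientAddGroup.addMonoidHom_ext
    apply FreeAbelianGroup.lift_ext
    rintro ⟨a, b⟩
    change d2 Q' (C2map f (c2 a b)) = FreeAbelianGroup.map f (d2 Q (c2 a b))
    simp [C2map_c2, d2_c2, map_rop]
  exact DFunLike.congr_fun h x

/-- The chain map `(a, b, c) ↦ (f a, f b, f c)` in degree `3`. -/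
def C3map (f : Q →◃ Q') : C3 Q →+ C3 Q' :=
  QuotientAddGroup.lift (D3 Q)
    (FreeAbelianGroup.lift fun x : Q × Q × Q => c3 (f x.1) (f x.2.1) (f x.2.2)) (by
    rw [D3, AddSubgroup.closure_le]
    rintro _ ⟨a, b, rfl | rfl⟩
    · simpa using c3_left (f a) (f b)
    · simpa using c3_right (f a) (f b))

theorem C3map_c3 (f : Q →◃ Q') (a b c : Q) : C3map f (c3 a b c) = c3 (f a) (f b) (f c) := by
  simp [C3map, c3]

theorem C2map_d3 (f : Q →◃ Q') (x : C3 Q) : C2map f (d3 Q x) = d3 Q' (C3map f x) := by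
  have h : (C2map f).comp (d3 Q) = (d3 Q').comp (C3map f) := by
    apply QuotientAddGroup.addMonoidHom_ext
    apply FreeAbelianGroup.lift_ext
    rintro ⟨a, b, c⟩
    change C2map f (d3 Q (c3 a b c)) = d3 Q' (C3map f (c3 a b c))
    simp only [C3map_c3, d3_c3, map_sub, C2map_c2, map_rop]
  exact DFunLike.congr_fun h x

/-- The map induced on `2`-cycles. -/
def Z2map (f : Q →◃ Q') : (d2 Q).ker →+ (d2 Q').ker :=
  ((C2map f).comp (d2 Q).ker.subtype).codRestrict (d2 Q').ker (by
    rintro ⟨x, hx⟩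
    rw [AddMonoidHom.mem_ker] at hx ⊢
    change d2 Q' (C2map f x) = 0
    rw [d2_C2map, hx, map_zero])

/-- The homomorphism `f_* : H₂(Q) → H₂(Q')` induced by a quandle homomorphism `f`. -/
def H2map (f : Q →◃ Q') : H2 Q →+ H2 Q' :=
  QuotientAddGroup.map _ _ (Z2map f) (by
    rintro ⟨x, hx⟩ ⟨y, hy⟩
    change d3 Q y = x at hy
    subst hy
    exact ⟨C3map f y, (C2map_d3 f y).symm⟩)

end Homology

end QuandleHurewicz

namespace QuandleHurewicz

open Quandles

/-! ### The action of the adjoint group, and balancing into the kernel of `ε`. -/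

section Action

variable {Q : Type*} [Quandle Q]

/-! A pair `(a, b)` is read as an edge from `a` to `a ∗ b`, so an element `g` of the adjoint group,
applied at `x`, traces a `2`-chain `κ(x, g)` with boundary `x - x ^ g`. The relation `adj b * adj (a
∗ b) = adj a * adj b` holds for these chains exactly modulo the boundaries of triples, so `κ` is a
well-defined cocycle: `κ(x, gh) = κ(x, g) + κ(x ^ g, h)` (`trace_mul`).

In the other direction, choose a path in `ker ε` from a base point to each `x`. An edge `(a, b)`,
replaced by `(adj a)⁻¹ * adj b` to have `ε`-degree zero and closed up by the chosen paths, is a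
loop. Its class `S.cls` is again a cocycle (`cls_mul`), hence kills boundaries. Degenerate pairs
match in both directions, because `adj a` fixes `a` and balances to `1`.

Tracing a loop and then closing up gives back its class (`chainHomB_trace`, `cls_base`), whence
surjectivity. Closing up and then tracing changes a chain only by a term depending on its boundary
(`sumTrace_chainHom`), whence injectivity on cycles. Changing the paths likewise contributes only
such a term, which gives naturality. -/

theorem Adj.induction {P : Adj Q → Prop} (one : P 1) (adj : ∀ a, P (adj a))
    (mul : ∀ g h, P g → P h → P (g * h)) (inv : ∀ g, P g → P g⁻¹) (g : Adj Q) : P g := by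
  have hg : g ∈ Subgroup.closure (Set.range (PresentedGroup.of (rels := adjRels Q))) := by
    rw [PresentedGroup.closure_range_of]; trivial
  induction hg using Subgroup.closure_induction with
  | mem x hx => obtain ⟨a, rfl⟩ := hx; exact adj a
  | one => exact one
  | mul x y _ _ hx hy => exact mul x y hx hy
  | inv x _ hx => exact inv x hx

@[simp] theorem Adj.eps_adj (a : Q) : Adj.eps (adj a) = Multiplicative.ofAdd 1 :=
  Adj.lift_adj _ _ a

/-- The generator attached to `a ^ g` is the conjugate by `g` of the generator attached to `a`. -/
theorem adj_act (a : Q) (g : Adj Q) : adj (Adj.act a g) = g⁻¹ * adj a * g := by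
  induction g using Adj.induction generalizing a with
  | one => simp [Adj.act_one]
  | adj b => rw [Adj.act_adj, adj_rop]
  | mul g h hg hh => rw [Adj.act_mul, hh, hg]; group
  | inv g hg =>
    have h := hg (Adj.act a g⁻¹)
    rw [← Adj.act_mul, inv_mul_cancel, Adj.act_one] at h
    rw [h]; group

theorem Adj.act_adj_self_zpow (a : Q) (n : ℤ) : Adj.act a (adj a ^ n) = a := by
  have h1 : Adj.act a (adj a) = a := by rw [Adj.act_adj, rop_self]
  have h2 : Adj.act a (adj a)⁻¹ = a := Adj.act_inv_eq _ _ _ h1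
  induction n using Int.induction_on with
  | zero => simp [Adj.act_one]
  | succ n hn => rw [zpow_add_one, Adj.act_mul, hn, h1]
  | pred n hn => rw [zpow_sub_one, Adj.act_mul, hn, h2]

theorem exists_adj_of_mem_inn {σ : Equiv.Perm Q} (hσ : σ ∈ Inn Q) :
    ∃ g : Adj Q, ∀ x, Adj.act x g = σ x := by
  induction hσ using Subgroup.closure_induction with
  | mem σ h => obtain ⟨a, rfl⟩ := h; exact ⟨adj a, fun x => Adj.act_adj x a⟩
  | one => exact ⟨1, Adj.act_one⟩
  | mul σ τ _ _ hσ hτ =>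
    obtain ⟨g, hg⟩ := hσ
    obtain ⟨h, hh⟩ := hτ
    exact ⟨h * g, fun x => by rw [Adj.act_mul, hh, hg]; rfl⟩
  | inv σ _ hσ =>
    obtain ⟨g, hg⟩ := hσ
    exact ⟨g⁻¹, fun x => Adj.act_inv_eq _ _ _ (by rw [hg]; exact σ.apply_symm_apply x)⟩

theorem act_mem_component (x : Q) (g : Adj Q) : Adj.act x g ∈ component x := by
  induction g using Adj.induction generalizing x with
  | one => rw [Adj.act_one]; exact MulAction.mem_orbit_self x
  | adj b =>
    rw [Adj.act_adj]
    exact ⟨⟨Rack.act' b, Subgroup.subset_closure ⟨b, rfl⟩⟩, rfl⟩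
  | mul g h hg hh =>
    rw [Adj.act_mul]
    have h1 := MulAction.orbit_eq_iff.2 (hg x)
    have h2 := hh (Adj.act x g)
    rw [component] at h2 ⊢
    rwa [h1] at h2
  | inv g hg =>
    have h := hg (Adj.act x g⁻¹)
    rw [← Adj.act_mul, inv_mul_cancel, Adj.act_one] at h
    exact MulAction.mem_orbit_symm.1 h

theorem toPi0_eq_iff (x y : Q) : toPi0 x = toPi0 y ↔ x ∈ component y := by
  unfold toPi0
  exact Quotient.eq.trans MulAction.orbitRel_apply

/-- `adj(x)^{-ε(g)} g`, the element of `ker ε` that moves `x` as `g` does. -/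
def balance (x : Q) (g : Adj Q) : Adj Q := adj x ^ (-(Adj.eps g).toAdd) * g

theorem eps_balance (x : Q) (g : Adj Q) : Adj.eps (balance x g) = 1 := by
  apply Multiplicative.toAdd.injective
  simp [balance]

theorem act_balance (x : Q) (g : Adj Q) : Adj.act x (balance x g) = Adj.act x g := by
  rw [balance, Adj.act_mul, Adj.act_adj_self_zpow]

/-- Moving powers of `adj x` past `g` conjugates them into powers of `adj (x ^ g)`, the correction
that balancing `h` at `x ^ g` requires. -/
theorem balance_mul (x : Q) (g h : Adj Q) :
    balance x (g * h) = balance x g * balance (Adj.act x g) h := by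
  have : (g⁻¹ * adj x * g) ^ (-(Adj.eps h).toAdd) =
      g⁻¹ * adj x ^ (-(Adj.eps h).toAdd) * g := by
    simpa using conj_zpow (i := -(Adj.eps h).toAdd) (a := g⁻¹) (b := adj x)
  simp only [balance, adj_act, this, map_mul, toAdd_mul, neg_add, zpow_add]
  group

theorem balance_adj (x b : Q) : balance x (adj b) = (adj x)⁻¹ * adj b := by simp [balance]

theorem balance_of_eps_eq_one (x : Q) {g : Adj Q} (hg : Adj.eps g = 1) : balance x g = g := by
  simp [balance, hg]

/-- Since `adj x` fixes `x`, balancing brings any connecting element into `ker ε` without moving its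
endpoint. -/
theorem exists_balanced_path {x y : Q} (h : toPi0 x = toPi0 y) :
    ∃ g : Adj Q, Adj.eps g = 1 ∧ Adj.act x g = y := by
  obtain ⟨⟨σ, hσ⟩, h⟩ := (toPi0_eq_iff y x).1 h.symm
  obtain ⟨g, hg⟩ := exists_adj_of_mem_inn hσ
  exact ⟨balance x g, eps_balance x g, by rw [act_balance, hg]; exact h⟩

end Action

/-! ### The chain traced by an element of the adjoint group. -/

section Cocycle

variable {Q : Type*} [Quandle Q]

/-- `2`-chains modulo boundaries. -/
abbrev C2ModB (Q : Type*) [Quandle Q] : Type _ := C2 Q ⧸ (d3 Q).range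

/-- The class of `(a, b)` in `C₂(Q)` modulo boundaries. -/
def c2b (a b : Q) : C2ModB Q := QuotientAddGroup.mk' (d3 Q).range (c2 a b)

theorem c2b_self (a : Q) : c2b a a = 0 := by rw [c2b, c2_self, map_zero]

/-- The vanishing of `∂(a, b, c)`, arranged as an equality of two two-step paths from `a`: this is
the adjoint relation for `extRho`. -/
theorem c2b_rop (a b c : Q) : c2b a c + c2b (a ∗ c) (b ∗ c) = c2b a b + c2b (a ∗ b) c := by
  have h : QuotientAddGroup.mk' (d3 Q).range (d3 Q (c3 a b c)) = 0 :=
    (QuotientAddGroup.eq_zero_iff _).2 ⟨_, rfl⟩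
  rw [d3_c3] at h
  simp only [map_sub] at h
  change (c2b a c - c2b (a ∗ b) c) - (c2b a b - c2b (a ∗ c) (b ∗ c)) = 0 at h
  rw [← sub_eq_zero, ← h]
  abel

/-- The permutation `(x, m) ↦ (x ∗ b, m + (x, b))` of `Q × C₂(Q) / B₂(Q)`. -/
def extPerm (b : Q) : Equiv.Perm (Q × C2ModB Q) where
  toFun y := (y.1 ∗ b, y.2 + c2b y.1 b)
  invFun y := ((Rack.act' b).symm y.1, y.2 - c2b ((Rack.act' b).symm y.1) b)
  left_inv y := by
    have h : (Rack.act' b).symm (y.1 ∗ b) = y.1 := (Rack.act' b).symm_apply_apply y.1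
    simp [h]
  right_inv y := by
    have h : (Rack.act' b).symm y.1 ∗ b = y.1 := (Rack.act' b).apply_symm_apply y.1
    exact Prod.ext h (sub_add_cancel _ _)

/-- The right action of `Adj(Q)` on `Q × C₂(Q) / B₂(Q)` that extends its action on `Q`. -/
def extRho : Adj Q →* (Equiv.Perm (Q × C2ModB Q))ᵐᵒᵖ :=
  Adj.lift (fun b => MulOpposite.op (extPerm b)) (by
    intro a b
    -- Clearing the inverse leaves `adj b * adj (a ∗ b) = adj a * adj b`, which only needs the
    -- forward maps of `extPerm`.
    rw [mul_assoc, eq_inv_mul_iff_mul_eq]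
    apply MulOpposite.unop_injective
    ext1 ⟨x, m⟩
    change ((x ∗ b) ∗ (a ∗ b), (m + c2b x b) + c2b (x ∗ b) (a ∗ b)) =
      ((x ∗ a) ∗ b, (m + c2b x a) + c2b (x ∗ a) b)
    rw [← rop_distrib, add_assoc, add_assoc, c2b_rop])

/-- The chain `κ(x, g)` traced out by `g` from `x`, modulo boundaries. -/
def trace (x : Q) (g : Adj Q) : C2ModB Q := ((extRho g).unop (x, 0)).2

theorem extRho_apply (g : Adj Q) (x : Q) (m : C2ModB Q) :
    (extRho g).unop (x, m) = (Adj.act x g, m + trace x g) := by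
  -- The generators commute with translations of the second coordinate, so the displacement `c` does
  -- not depend on `m`.
  have key : ∀ x : Q, ∃ c : C2ModB Q, ∀ m, (extRho g).unop (x, m) = (Adj.act x g, m + c) := by
    induction g using Adj.induction with
    | one => exact fun x => ⟨0, fun m => by simp [Adj.act_one]⟩
    | adj b =>
      exact fun x => ⟨c2b x b, fun m => by rw [extRho, Adj.lift_adj, Adj.act_adj]; rfl⟩
    | mul g h hg hh =>
      intro x
      obtain ⟨c, hc⟩ := hg x
      obtain ⟨d, hd⟩ := hh (Adj.act x g)
      refine ⟨c + d, fun m => ?_⟩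
      rw [map_mul, MulOpposite.unop_mul, Equiv.Perm.mul_apply, hc, hd, Adj.act_mul, add_assoc]
    | inv g hg =>
      intro x
      obtain ⟨c, hc⟩ := hg (Adj.act x g⁻¹)
      refine ⟨-c, fun m => ?_⟩
      rw [map_inv, MulOpposite.unop_inv, Equiv.Perm.inv_eq_iff_eq, hc, ← Adj.act_mul,
        inv_mul_cancel, Adj.act_one, neg_add_cancel_right]
  obtain ⟨c, hc⟩ := key x
  rw [trace, hc, hc, zero_add]

theorem trace_mul (x : Q) (g h : Adj Q) :
    trace x (g * h) = trace x g + trace (Adj.act x g) h := by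
  have h1 := extRho_apply (g * h) x 0
  rw [map_mul, MulOpposite.unop_mul, Equiv.Perm.mul_apply, extRho_apply, extRho_apply] at h1
  simpa using (congrArg Prod.snd h1).symm

theorem trace_one (x : Q) : trace x 1 = 0 := by simp [trace]

theorem trace_adj (x b : Q) : trace x (adj b) = c2b x b := by
  simp [trace, extRho, extPerm]

theorem trace_inv (x : Q) (g : Adj Q) : trace (Adj.act x g) g⁻¹ = -trace x g := by
  have h := trace_mul x g g⁻¹
  rw [mul_inv_cancel, trace_one] at h
  exact (neg_eq_of_add_eq_zero_right h.symm).symm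

/-- Balancing costs nothing: `adj x` stays at `x` and traces the degenerate pair `(x, x)`. -/
theorem trace_balance_adj (x b : Q) : trace x ((adj x)⁻¹ * adj b) = c2b x b := by
  have h1 : Adj.act x (adj x) = x := by rw [Adj.act_adj, rop_self]
  have h2 := trace_inv x (adj x)
  rw [h1, trace_adj, c2b_self, neg_zero] at h2
  rw [trace_mul, h2, Adj.act_inv_eq _ _ _ h1, trace_adj, zero_add]

theorem act_mem_component_of_mem {q a : Q} (ha : a ∈ component q) (g : Adj Q) :
    Adj.act a g ∈ component q := by
  have h := act_mem_component a g
  rw [component] at h ⊢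
  rwa [MulAction.orbit_eq_iff.2 ha] at h

/-- `κ(x, g)` is represented by a chain in the component of `x`. -/
theorem exists_mem_C2Part (q : Q) (g : Adj Q) : ∀ x ∈ component q,
    ∃ z ∈ C2Part q, QuotientAddGroup.mk' (d3 Q).range z = trace x g := by
  induction g using Adj.induction with
  | one => exact fun x _ => ⟨0, zero_mem _, by rw [trace_one, map_zero]⟩
  | adj b =>
    exact fun x hx => ⟨c2 x b, AddSubgroup.subset_closure ⟨x, b, hx, rfl⟩, (trace_adj x b).symm⟩
  | mul g h hg hh =>
    intro x hx
    obtain ⟨z, hz, hz'⟩ := hg x hx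
    obtain ⟨w, hw, hw'⟩ := hh (Adj.act x g) (act_mem_component_of_mem hx g)
    exact ⟨z + w, add_mem hz hw, by rw [map_add, hz', hw', trace_mul]⟩
  | inv g hg =>
    intro x hx
    obtain ⟨z, hz, hz'⟩ := hg (Adj.act x g⁻¹) (act_mem_component_of_mem hx _)
    refine ⟨-z, neg_mem hz, ?_⟩
    have h := trace_inv (Adj.act x g⁻¹) g
    rw [← Adj.act_mul, inv_mul_cancel, Adj.act_one] at h
    rw [map_neg, hz', h]

/-- The boundary map on `2`-chains modulo boundaries. -/
def d2b (Q : Type*) [Quandle Q] : C2ModB Q →+ C1 Q :=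
  QuotientAddGroup.lift (d3 Q).range (d2 Q) (by
    rintro _ ⟨y, rfl⟩
    exact DFunLike.congr_fun d2_comp_d3 y)

/-- The boundary telescopes along the path, so loops trace cycles. -/
theorem d2b_trace (x : Q) (g : Adj Q) :
    d2b Q (trace x g) = FreeAbelianGroup.of x - FreeAbelianGroup.of (Adj.act x g) := by
  induction g using Adj.induction generalizing x with
  | one => simp [trace_one, Adj.act_one]
  | adj b => rw [trace_adj, Adj.act_adj]; exact d2_c2 x b
  | mul g h hg hh => rw [trace_mul, map_add, hg, hh, Adj.act_mul]; abel
  | inv g hg =>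
    have h := trace_inv (Adj.act x g⁻¹) g
    have h' := hg (Adj.act x g⁻¹)
    rw [← Adj.act_mul, inv_mul_cancel, Adj.act_one] at h h'
    rw [h, map_neg, h', neg_sub]

theorem C2.hom_ext {A : Type*} [AddCommGroup A] {φ ψ : C2 Q →+ A}
    (h : ∀ a b, φ (c2 a b) = ψ (c2 a b)) : φ = ψ := by
  apply QuotientAddGroup.addMonoidHom_ext
  apply FreeAbelianGroup.lift_ext
  rintro ⟨a, b⟩
  exact h a b

end Cocycle

/-! ### Classes of loops in the direct sum. -/

section LoopClass

variable {I Q : Type*} [Quandle Q]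

open Classical in
/-- The class of `g ∈ π₁(Q, q i)` in the `i`-th summand of `⨁ i, π₁(Q, q i)_ab`; it is `0` by
convention when `g` is not in `π₁(Q, q i)`. -/
noncomputable def loopClass (q : I → Q) (i : I) (g : Adj Q) :
    DirectSum I fun i => PiOneAb (q i) :=
  if h : g ∈ piOne (q i) then
    DirectSum.of (fun i => PiOneAb (q i)) i (Additive.ofMul (Abelianization.of ⟨g, h⟩))
  else 0

theorem mem_piOne {q : Q} {g : Adj Q} : g ∈ piOne q ↔ Adj.eps g = 1 ∧ Adj.act q g = q := Iff.rfl

variable (q : I → Q) (i : I)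

open Classical in
theorem loopClass_of_mem {g : Adj Q} (h : g ∈ piOne (q i)) : loopClass q i g =
    DirectSum.of (fun i => PiOneAb (q i)) i (Additive.ofMul (Abelianization.of ⟨g, h⟩)) :=
  dif_pos h

theorem loopClass_mul {g h : Adj Q} (hg : g ∈ piOne (q i)) (hh : h ∈ piOne (q i)) :
    loopClass q i (g * h) = loopClass q i g + loopClass q i h := by
  classical
  rw [loopClass_of_mem q i hg, loopClass_of_mem q i hh, loopClass_of_mem q i (mul_mem hg hh),
    ← map_add]
  rfl

theorem loopClass_one : loopClass q i 1 = 0 := by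
  have h := loopClass_mul q i (one_mem _) (one_mem _)
  rw [mul_one] at h
  exact left_eq_add.1 h

theorem loopClass_inv {g : Adj Q} (hg : g ∈ piOne (q i)) :
    loopClass q i g⁻¹ = -loopClass q i g := by
  have h := loopClass_mul q i hg (inv_mem hg)
  rw [mul_inv_cancel, loopClass_one] at h
  exact (neg_eq_of_add_eq_zero_right h.symm).symm

theorem loopClass_apply_of_ne {j : I} (h : j ≠ i) (g : Adj Q) : loopClass q i g j = 0 := by
  classical
  by_cases hg : g ∈ piOne (q i)
  · rw [loopClass_of_mem q i hg]
    exact DirectSum.of_eq_of_ne _ _ _ h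
  · rw [loopClass, dif_neg hg]; rfl

theorem eq_loopClass_of_apply_eq_zero {x : DirectSum I fun i => PiOneAb (q i)}
    (h : ∀ j, j ≠ i → x j = 0) : ∃ g ∈ piOne (q i), x = loopClass q i g := by
  classical
  obtain ⟨⟨g, hg⟩, hgx⟩ := QuotientGroup.mk_surjective (x i).toMul
  refine ⟨g, hg, ?_⟩
  rw [loopClass_of_mem q i hg]
  have hx : Additive.ofMul (Abelianization.of ⟨g, hg⟩) = x i := hgx
  rw [hx]
  refine DFinsupp.ext fun j => ?_
  by_cases hj : j = i
  · subst hj; exact (DirectSum.of_eq_same (β := fun i => PiOneAb (q i)) _ _).symm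
  · rw [h j hj]; exact (DirectSum.of_eq_of_ne (β := fun i => PiOneAb (q i)) _ _ _ hj).symm

theorem closure_loopClass_eq_top :
    AddSubgroup.closure {x | ∃ i, ∃ g ∈ piOne (q i), x = loopClass q i g} = ⊤ := by
  classical
  rw [eq_top_iff]
  rintro x -
  induction x using DirectSum.induction_on with
  | zero => exact zero_mem _
  | of i y =>
    obtain ⟨⟨g, hg⟩, rfl⟩ := QuotientGroup.mk_surjective (Additive.toMul y)
    exact AddSubgroup.subset_closure ⟨i, g, hg, (loopClass_of_mem q i hg).symm⟩
  | add x y hx hy => exact add_mem hx hy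

theorem map_mem_piOne {Q' : Type*} [Quandle Q'] (f : Q →◃ Q') {q : Q} {q' : Q'} (hf : f q = q')
    {g : Adj Q} (hg : g ∈ piOne q) : Adj.map f g ∈ piOne q' :=
  (piOneMap f hf ⟨g, hg⟩).2

theorem map_loopClass {Q' : Type*} [Quandle Q'] (q' : I → Q') (f : Q →◃ Q')
    (hf : ∀ i, f (q i) = q' i) {g : Adj Q} (hg : g ∈ piOne (q i)) :
    DirectSum.map (fun i => piOneAbMap f (hf i)) (loopClass q i g) =
      loopClass q' i (Adj.map f g) := by
  classical
  rw [loopClass_of_mem q i hg, loopClass_of_mem q' i (map_mem_piOne f (hf i) hg),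
    DirectSum.map_of]
  rfl

end LoopClass

/-- A choice, for every `x`, of the index of a base point and of an element of `ker ε` that moves
this base point to `x`. -/
structure PathSystem {I Q : Type*} [Quandle Q] (q : I → Q) where
  idx : Q → I
  path : Q → Adj Q
  eps_path : ∀ x, Adj.eps (path x) = 1
  act_path : ∀ x, Adj.act (q (idx x)) (path x) = x

theorem WellPointed.nonempty_pathSystem {I Q : Type*} [Quandle Q] {q : I → Q}
    (hq : WellPointed q) : Nonempty (PathSystem q) := by
  have h : ∀ x, ∃ i, ∃ g : Adj Q, Adj.eps g = 1 ∧ Adj.act (q i) g = x := fun x => by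
    obtain ⟨i, hi⟩ := hq.2 (toPi0 x)
    exact ⟨i, exists_balanced_path hi⟩
  choose idx path h using h
  exact ⟨⟨idx, path, fun x => (h x).1, fun x => (h x).2⟩⟩

/-! ### Closing up edges to loops along chosen paths. -/

namespace PathSystem

variable {I Q : Type*} [Quandle Q] {q : I → Q} (S : PathSystem q)

theorem idx_eq (hq : WellPointed q) {i : I} {x : Q} {g : Adj Q} (h : Adj.act (q i) g = x) :
    S.idx x = i := by
  apply hq.1
  change toPi0 (q (S.idx x)) = toPi0 (q i)
  have h1 := (toPi0_eq_iff _ _).2 (act_mem_component (q (S.idx x)) (S.path x))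
  have h2 := (toPi0_eq_iff _ _).2 (act_mem_component (q i) g)
  rw [S.act_path] at h1
  rw [h] at h2
  rw [← h1, h2]

theorem idx_act (hq : WellPointed q) (x : Q) (g : Adj Q) : S.idx (Adj.act x g) = S.idx x :=
  S.idx_eq hq (g := S.path x * g) (by rw [Adj.act_mul, S.act_path])

theorem idx_base (hq : WellPointed q) (i : I) : S.idx (q i) = i :=
  S.idx_eq hq (Adj.act_one _)

/-- The loop obtained from `g`, balanced at `x`, by joining its ends to the base point. -/
def loop (x : Q) (g : Adj Q) : Adj Q :=
  S.path x * balance x g * (S.path (Adj.act x g))⁻¹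

theorem loop_mem (hq : WellPointed q) (x : Q) (g : Adj Q) :
    S.loop x g ∈ piOne (q (S.idx x)) := by
  refine mem_piOne.2 ⟨by simp [loop, S.eps_path, eps_balance], ?_⟩
  rw [loop, Adj.act_mul, Adj.act_mul, S.act_path, act_balance]
  refine Adj.act_inv_eq _ _ _ ?_
  conv_lhs => rw [← S.idx_act hq x g]
  exact S.act_path _

/-- The chosen path to the intermediate point is run back and forth, and cancels. -/
theorem loop_mul (x : Q) (g h : Adj Q) :
    S.loop x (g * h) = S.loop x g * S.loop (Adj.act x g) h := by
  simp only [loop, balance_mul, Adj.act_mul]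
  group

/-- The class of `loop x g` in the summand of the component of `x`. -/
noncomputable def cls (x : Q) (g : Adj Q) : DirectSum I fun i => PiOneAb (q i) :=
  loopClass q (S.idx x) (S.loop x g)

theorem cls_mul (hq : WellPointed q) (x : Q) (g h : Adj Q) :
    S.cls x (g * h) = S.cls x g + S.cls (Adj.act x g) h := by
  have h1 := S.loop_mem hq (Adj.act x g) h
  simp only [cls]
  rw [S.idx_act hq] at h1 ⊢
  rw [loop_mul, loopClass_mul q _ (S.loop_mem hq x g) h1]

theorem cls_one (hq : WellPointed q) (x : Q) : S.cls x 1 = 0 := by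
  have h := S.cls_mul hq x 1 1
  rw [mul_one, Adj.act_one] at h
  exact left_eq_add.1 h

theorem cls_inv (hq : WellPointed q) (x : Q) (g : Adj Q) :
    S.cls (Adj.act x g) g⁻¹ = -S.cls x g := by
  have h := S.cls_mul hq x g g⁻¹
  rw [mul_inv_cancel, S.cls_one hq] at h
  exact (neg_eq_of_add_eq_zero_right h.symm).symm

theorem cls_adj_self (x : Q) : S.cls x (adj x) = 0 := by
  rw [cls, loop, balance_adj, Adj.act_adj, rop_self]
  simp [loopClass_one]

/-- The chosen path at `q i` need not be `1`, but it is a loop, and conjugation by a loop is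
invisible in the abelianization. -/
theorem cls_base (hq : WellPointed q) {i : I} {g : Adj Q} (hg : g ∈ piOne (q i)) :
    S.cls (q i) g = loopClass q i g := by
  have hp : S.path (q i) ∈ piOne (q i) := by
    refine mem_piOne.2 ⟨S.eps_path _, ?_⟩
    have h := S.act_path (q i)
    rwa [S.idx_base hq] at h
  rw [cls, S.idx_base hq, loop, hg.2, balance_of_eps_eq_one _ hg.1,
    loopClass_mul _ _ (mul_mem hp hg) (inv_mem hp), loopClass_mul _ _ hp hg,
    loopClass_inv _ _ hp]
  abel

/-- The Hurewicz homomorphism on `2`-chains. -/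
noncomputable def chainHom : C2 Q →+ DirectSum I fun i => PiOneAb (q i) :=
  QuotientAddGroup.lift (D2 Q)
    (FreeAbelianGroup.lift fun x : Q × Q => S.cls x.1 (adj x.2)) (by
    rw [D2, AddSubgroup.closure_le]
    rintro _ ⟨a, rfl⟩
    simp [cls_adj_self])

theorem chainHom_c2 (a b : Q) : S.chainHom (c2 a b) = S.cls a (adj b) := by
  simp [chainHom, c2]

theorem chainHom_comp_d3 (hq : WellPointed q) : S.chainHom.comp (d3 Q) = 0 := by
  apply QuotientAddGroup.addMonoidHom_ext
  apply FreeAbelianGroup.lift_ext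
  rintro ⟨a, b, c⟩
  change S.chainHom (d3 Q (c3 a b c)) = 0
  -- The cocycle `S.cls a`, evaluated on both sides, gives the four terms of `∂(a, b, c)`.
  have h : adj b * adj c = adj c * adj (b ∗ c) := by rw [adj_rop]; group
  have h' := congrArg (S.cls a) h
  rw [S.cls_mul hq, S.cls_mul hq, Adj.act_adj, Adj.act_adj] at h'
  rw [d3_c3]
  simp only [map_sub, chainHom_c2]
  rw [← sub_eq_zero.2 h'.symm]
  abel

/-- The homomorphism induced by `chainHom` on chains modulo boundaries. -/
noncomputable def chainHomB (hq : WellPointed q) :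
    C2ModB Q →+ DirectSum I fun i => PiOneAb (q i) :=
  QuotientAddGroup.lift (d3 Q).range S.chainHom (by
    rintro _ ⟨y, rfl⟩
    exact DFunLike.congr_fun (S.chainHom_comp_d3 hq) y)

/-- Both sides are cocycles in `g` that agree on the generators. -/
theorem chainHomB_trace (hq : WellPointed q) (x : Q) (g : Adj Q) :
    S.chainHomB hq (trace x g) = S.cls x g := by
  induction g using Adj.induction generalizing x with
  | one => rw [trace_one, map_zero, S.cls_one hq]
  | adj b => rw [trace_adj]; exact S.chainHom_c2 x b
  | mul g h hg hh => rw [trace_mul, map_add, hg, hh, S.cls_mul hq]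
  | inv g hg =>
    have h1 := trace_inv (Adj.act x g⁻¹) g
    have h2 := S.cls_inv hq (Adj.act x g⁻¹) g
    have h3 := hg (Adj.act x g⁻¹)
    rw [← Adj.act_mul, inv_mul_cancel, Adj.act_one] at h1 h2
    rw [h1, h2, map_neg, h3]

theorem exists_cycle (hq : WellPointed q) {i : I} {g : Adj Q} (hg : g ∈ piOne (q i)) :
    ∃ z ∈ C2Part (q i), d2 Q z = 0 ∧ S.chainHom z = loopClass q i g := by
  obtain ⟨z, hz, hzg⟩ := exists_mem_C2Part (q i) g (q i) (MulAction.mem_orbit_self _)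
  refine ⟨z, hz, ?_, ?_⟩
  · have h := d2b_trace (q i) g
    rw [← hzg, hg.2, sub_self] at h
    exact h
  · have h := S.chainHomB_trace hq (q i) g
    rw [← hzg, S.cls_base hq hg] at h
    exact h

theorem chainHom_apply_of_mem (hq : WellPointed q) {i j : I} (hj : j ≠ i) {z : C2 Q}
    (hz : z ∈ C2Part (q i)) : S.chainHom z j = 0 := by
  induction hz using AddSubgroup.closure_induction with
  | mem z h =>
    obtain ⟨a, b, ha, rfl⟩ := h
    obtain ⟨g, -, rfl⟩ := exists_balanced_path ((toPi0_eq_iff _ _).2 ha).symm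
    rw [chainHom_c2, cls, S.idx_eq hq rfl]
    exact loopClass_apply_of_ne q i hj _
  | zero => rw [map_zero]; rfl
  | add x y _ _ hx hy => rw [map_add, DirectSum.add_apply, hx, hy, add_zero]
  | neg x _ hx =>
    rw [map_neg]
    exact (DFinsupp.neg_apply _ _).trans (by rw [hx, neg_zero])

/-! ### The inverse by tracing loops, bijectivity and the grading. -/

/-- The homomorphism `π₁(Q, q)_ab → C₂(Q) / B₂(Q)` induced by `g ↦ κ(q, g)`. -/
def traceHom (q : Q) : PiOneAb q →+ C2ModB Q :=
  AddMonoidHom.toMultiplicativeRight.symm (Abelianization.lift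
    { toFun := fun g : piOne q => Multiplicative.ofAdd (trace q g)
      map_one' := by simp [trace_one]
      map_mul' := fun g h => by
        rw [Subgroup.coe_mul, trace_mul, g.2.2, ofAdd_add] })

open Classical in
/-- The sum over the components of the homomorphisms `traceHom`. -/
noncomputable def sumTrace (q : I → Q) : (DirectSum I fun i => PiOneAb (q i)) →+ C2ModB Q :=
  DirectSum.toAddMonoid fun i => traceHom (q i)

theorem sumTrace_loopClass {i : I} {g : Adj Q} (hg : g ∈ piOne (q i)) :
    sumTrace q (loopClass q i g) = trace (q i) g := by
  classical
  rw [loopClass_of_mem q i hg, sumTrace, DirectSum.toAddMonoid_of]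
  rfl

/-- For `z = (a, b)` the closed-up loop traces the path to `a`, the edge, and the path to `a ∗ b`
backwards. The two path terms depend only on `∂z`, so they vanish on cycles. -/
theorem sumTrace_chainHom (hq : WellPointed q) (z : C2 Q) :
    sumTrace q (S.chainHom z) = QuotientAddGroup.mk' (d3 Q).range z +
      FreeAbelianGroup.lift (fun x => trace (q (S.idx x)) (S.path x)) (d2 Q z) := by
  have h : (sumTrace q).comp S.chainHom = QuotientAddGroup.mk' (d3 Q).range +
      (FreeAbelianGroup.lift (fun x => trace (q (S.idx x)) (S.path x))).comp (d2 Q) := by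
    refine C2.hom_ext fun a b => ?_
    simp only [AddMonoidHom.comp_apply, AddMonoidHom.add_apply, d2_c2, map_sub,
      FreeAbelianGroup.lift_apply_of, chainHom_c2]
    have hab := S.act_path (a ∗ b)
    have hi : S.idx (a ∗ b) = S.idx a := by rw [← Adj.act_adj, S.idx_act hq]
    rw [hi] at hab
    have h2 := trace_inv (q (S.idx a)) (S.path (a ∗ b))
    rw [hab] at h2
    rw [cls, sumTrace_loopClass (S.loop_mem hq a _), loop, trace_mul, trace_mul, Adj.act_mul,
      S.act_path, act_balance, Adj.act_adj, balance_adj, trace_balance_adj, h2, hi]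
    change _ = c2b a b + _
    abel
  exact DFunLike.congr_fun h z

/-- The Hurewicz homomorphism `H₂(Q) → ⨁ i, π₁(Q, q i)_ab`. -/
noncomputable def hurewiczHom (hq : WellPointed q) :
    H2 Q →+ DirectSum I fun i => PiOneAb (q i) :=
  QuotientAddGroup.lift _ (S.chainHom.comp (d2 Q).ker.subtype) (by
    rintro ⟨x, hx⟩ ⟨y, rfl⟩
    exact DFunLike.congr_fun (S.chainHom_comp_d3 hq) y)

theorem hurewiczHom_mk (hq : WellPointed q) (z : (d2 Q).ker) :
    S.hurewiczHom hq (QuotientAddGroup.mk' _ z) = S.chainHom z := rfl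

theorem hurewiczHom_injective (hq : WellPointed q) : Function.Injective (S.hurewiczHom hq) := by
  rw [injective_iff_map_eq_zero]
  intro x hx
  obtain ⟨⟨z, hz⟩, rfl⟩ := QuotientAddGroup.mk'_surjective _ x
  rw [hurewiczHom_mk] at hx
  have h := S.sumTrace_chainHom hq z
  rw [hx, AddMonoidHom.mem_ker.1 hz, map_zero, map_zero, add_zero] at h
  have hz' : z ∈ (d3 Q).range := (QuotientAddGroup.eq_zero_iff _).1 h.symm
  exact (QuotientAddGroup.eq_zero_iff _).2 hz'

theorem exists_mem_H2Part (hq : WellPointed q) {i : I} {g : Adj Q} (hg : g ∈ piOne (q i)) :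
    ∃ x ∈ H2Part (q i), S.hurewiczHom hq x = loopClass q i g := by
  obtain ⟨z, hz, hz0, hzg⟩ := S.exists_cycle hq hg
  exact ⟨_, ⟨⟨z, hz0⟩, hz, rfl⟩, hzg⟩

theorem hurewiczHom_surjective (hq : WellPointed q) : Function.Surjective (S.hurewiczHom hq) := by
  rw [← AddMonoidHom.range_eq_top, eq_top_iff, ← closure_loopClass_eq_top, AddSubgroup.closure_le]
  rintro _ ⟨i, g, hg, rfl⟩
  obtain ⟨x, -, hx⟩ := S.exists_mem_H2Part hq hg
  exact ⟨x, hx⟩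

/-- The Hurewicz isomorphism `H₂(Q) ≃ ⨁ i, π₁(Q, q i)_ab`. -/
noncomputable def hurewiczEquiv (hq : WellPointed q) :
    H2 Q ≃+ DirectSum I fun i => PiOneAb (q i) :=
  AddEquiv.ofBijective (S.hurewiczHom hq)
    ⟨S.hurewiczHom_injective hq, S.hurewiczHom_surjective hq⟩

/-- For the converse, an image concentrated in the summand `i` is the class of one loop, which has a
preimage in `H2Part (q i)`; injectivity identifies it with `x`. -/
theorem mem_H2Part_iff (hq : WellPointed q) (i : I) (x : H2 Q) :
    x ∈ H2Part (q i) ↔ ∀ j : I, j ≠ i → S.hurewiczHom hq x j = 0 := by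
  constructor
  · rintro ⟨z, hz, rfl⟩ j hj
    exact S.chainHom_apply_of_mem hq hj hz
  · intro h
    obtain ⟨g, hg, hxg⟩ := eq_loopClass_of_apply_eq_zero q i h
    obtain ⟨y, hy, hyg⟩ := S.exists_mem_H2Part hq hg
    rwa [S.hurewiczHom_injective hq (hxg.trans hyg.symm)]

variable {Q' : Type*} [Quandle Q'] {q' : I → Q'} (S' : PathSystem q')

/-- Up to a boundary term, `chainHom` is natural. -/
theorem chainHom_C2map (hq : WellPointed q) (hq' : WellPointed q') (f : Q →◃ Q')
    (hf : ∀ i, f (q i) = q' i) (z : C2 Q) :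
    S'.chainHom (C2map f z) =
      DirectSum.map (fun i => piOneAbMap f (hf i)) (S.chainHom z) +
      FreeAbelianGroup.lift (fun x => loopClass q' (S.idx x)
        (S'.path (f x) * (Adj.map f (S.path x))⁻¹)) (d2 Q z) := by
  have hact (x : Q) : Adj.act (q' (S.idx x)) (Adj.map f (S.path x)) = f x := by
    rw [← hf, ← Adj.map_act, S.act_path]
  have hidx (x : Q) : S'.idx (f x) = S.idx x := S'.idx_eq hq' (hact x)
  -- The path chosen at `f x` and the image of the path chosen at `x` join the same points, so they
  -- differ by a loop.
  have hmem (x : Q) : S'.path (f x) * (Adj.map f (S.path x))⁻¹ ∈ piOne (q' (S.idx x)) := by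
    refine mem_piOne.2 ⟨by simp [S'.eps_path, Adj.eps_map, S.eps_path], ?_⟩
    have h := S'.act_path (f x)
    rw [hidx] at h
    rw [Adj.act_mul, h]
    exact Adj.act_inv_eq _ _ _ (hact x)
  have h : S'.chainHom.comp (C2map f) =
      (DirectSum.map fun i => piOneAbMap f (hf i)).comp S.chainHom +
      (FreeAbelianGroup.lift (fun x => loopClass q' (S.idx x)
        (S'.path (f x) * (Adj.map f (S.path x))⁻¹))).comp (d2 Q) := by
    refine C2.hom_ext fun a b => ?_
    simp only [AddMonoidHom.comp_apply, AddMonoidHom.add_apply, d2_c2, map_sub,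
      FreeAbelianGroup.lift_apply_of, chainHom_c2, C2map_c2]
    have hi : S.idx (a ∗ b) = S.idx a := by rw [← Adj.act_adj, S.idx_act hq]
    have hm := hmem (a ∗ b)
    rw [hi] at hm
    have hl := map_mem_piOne f (hf _) (S.loop_mem hq a (adj b))
    rw [cls, cls, map_loopClass q _ q' f hf (S.loop_mem hq a _), hi, hidx, sub_eq_add_neg,
      ← loopClass_inv _ _ hm, add_left_comm, ← loopClass_mul _ _ hl (inv_mem hm),
      ← loopClass_mul _ _ (hmem a) (mul_mem hl (inv_mem hm))]
    congr 1
    simp only [loop, balance_adj, Adj.act_adj, map_mul, map_inv, Adj.map_adj, map_rop]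
    group
  exact DFunLike.congr_fun h z

theorem hurewiczHom_H2map (hq : WellPointed q) (hq' : WellPointed q') (f : Q →◃ Q')
    (hf : ∀ i, f (q i) = q' i) (x : H2 Q) :
    S'.hurewiczHom hq' (H2map f x) =
      DirectSum.map (fun i => piOneAbMap f (hf i)) (S.hurewiczHom hq x) := by
  obtain ⟨⟨z, hz⟩, rfl⟩ := QuotientAddGroup.mk'_surjective _ x
  have h := S.chainHom_C2map S' hq hq' f hf z
  rw [AddMonoidHom.mem_ker.1 hz, map_zero, add_zero] at h
  exact h

end PathSystem

end QuandleHurewicz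

open Quandles QuandleHurewicz in
/-- For a fixed index set `I`, there is a family of isomorphisms
`H₂(Q) ≅ ⨁ i, π₁(Q, q i)_ab`, one for each well-pointed quandle `(Q, q)` indexed by `I`, which is
graded (the part of `H₂(Q)` in the component of `q i` is exactly what corresponds to the `i`-th
summand) and natural in homomorphisms of pointed quandles. -/
theorem theorem9p4 (I : Type u) :
    ∃ Φ : ∀ (Q : Type v) [Quandle Q] (q : I → Q), WellPointed q →
        (H2 Q ≃+ DirectSum I fun i => PiOneAb (q i)),
      (∀ (Q : Type v) [Quandle Q] (q : I → Q) (hq : WellPointed q) (i : I) (x : H2 Q),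
        x ∈ H2Part (q i) ↔ ∀ j : I, j ≠ i → Φ Q q hq x j = 0) ∧
      (∀ (Q Q' : Type v) [Quandle Q] [Quandle Q'] (q : I → Q) (q' : I → Q')
        (hq : WellPointed q) (hq' : WellPointed q') (f : Q →◃ Q') (hf : ∀ i, f (q i) = q' i)
        (x : H2 Q),
        Φ Q' q' hq' (H2map f x) =
          DirectSum.map (fun i => piOneAbMap f (hf i)) (Φ Q q hq x)) := by
  -- Paths are chosen independently for each quandle; no compatibility with `f` is needed, as
  -- `hurewiczHom_H2map` holds for arbitrary path systems.
  refine ⟨fun Q _ q hq => hq.nonempty_pathSystem.some.hurewiczEquiv hq, ?_, ?_⟩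
  · intro Q _ q hq i x
    exact hq.nonempty_pathSystem.some.mem_H2Part_iff hq i x
  · intro Q Q' _ _ q q' hq hq' f hf x
    exact hq.nonempty_pathSystem.some.hurewiczHom_H2map hq'.nonempty_pathSystem.some hq hq' f hf x
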